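/- Three-time-level representation formula for the 2D wave equation. Let $c>0$, let $I\subseteq\mathbb{R}$ be an interval, and let $u=u(\mathbf{x},t)$ be a real-valued classical solution on $\mathbb{R}^2\times I$ of $$\frac{\partial^2 u}{\partial t^2}-c^2\left(\frac{\partial^2 u}{\partial x_1^2}+\frac{\partial^2 u}{\partial x_2^2}\right)=0,$$ that is, $u$ is continuous on $\mathbb{R}^2\times I$, twice continuously differentiable on $\mathbb{R}^2\times\operatorname{int} I$, and satisfies the equation there. Let $t_*,\tau\in\mathbb{R}$ be such that $t_*+\tau\in I$ and $t_*-\tau\in I$. Then for every $\mathbf{x}\in\mathbb{R}^2$ $$u(\mathbf{x},t_*+\tau)+u(\mathbf{x},t_*-\tau)=\frac{1}{\pi}\int_{|\mathbf{z}|<1}\frac{u(\mathbf{x}+c\tau\mathbf{z},t_*)+c\tau\,\nabla u(\mathbf{x}+c\tau\mathbf{z},t_*)\cdot\mathbf{z}}{\sqrt{1-|\mathbf{z}|^2}}\,dz_1\,dz_2,$$ where $\nabla$ is the gradient in the space variables and the integral on the right converges absolutely. (If $\tau=0$, the gradient term is read as $0$.) -/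

import Mathlib

/-- `u : ℝ² → ℝ → ℝ` (space variable first, then time) is a classical solution on `ℝ² × I`, where
`I` is a time interval, of the wave equation `∂²u/∂t² - c² (∂²u/∂x₁² + ∂²u/∂x₂²) = 0`: it is
continuous up to the end points of `I` that belong to `I`, and at the interior times it is twice
continuously differentiable in space and time jointly and satisfies the equation pointwise. -/
structure IsWaveSolutionOn (c : ℝ) (I : Set ℝ) (u : EuclideanSpace ℝ (Fin 2) → ℝ → ℝ) : Prop where
  continuousOn : ContinuousOn (fun p : EuclideanSpace ℝ (Fin 2) × ℝ => u p.1 p.2) (Set.univ ×ˢ I)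
  contDiffOn : ContDiffOn ℝ 2 (fun p : EuclideanSpace ℝ (Fin 2) × ℝ => u p.1 p.2)
    (Set.univ ×ˢ interior I)
  equation : ∀ x : EuclideanSpace ℝ (Fin 2), ∀ t ∈ interior I,
    deriv (deriv (fun s => u x s)) t
      - c ^ 2 * Laplacian.laplacian (fun y : EuclideanSpace ℝ (Fin 2) => u y t) x = 0

/-- The integrand `(f(x + cτz) + cτ ∇f(x + cτz) · z) / √(1 - |z|²)` of the three-time-level
formula, for a function `f` on the plane, as a function of `z`. -/
noncomputable def waveKernelIntegrand (c τ : ℝ) (f : EuclideanSpace ℝ (Fin 2) → ℝ)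
    (x z : EuclideanSpace ℝ (Fin 2)) : ℝ :=
  (f (x + (c * τ) • z) + c * τ * inner ℝ (gradient f (x + (c * τ) • z)) z) /
    Real.sqrt (1 - ‖z‖ ^ 2)

/-! Follow the backward characteristic cone from an apex at time T: at depth σ, integrate u + σ
Du·(cz, 1) at (x + cσz, T - σ) over the unit disk with weight 1/√(1 - |z|²). By the wave equation
the σ-derivative of this integral vanishes: it is c times the expression in
`integral_diskMeasure_laplacian_identity` with r = cσ. That identity holds because, in polar
coordinates, its integrand is a radial derivative vanishing at both ends plus a periodic angular
derivative. So the integral keeps its value 2πu(x, T) from depth 0 (`integral_diskMeasure_cone`).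

Taking T = t + τ, and then reversing time for T = t - τ, gives two formulas over the same base disk
at time t. Their time-derivative terms are opposite, so adding them leaves only u and its spatial
gradient. This needs u to be C² at the times involved; end points of I are reached by replacing τ
with sτ and letting s → 1. -/

open MeasureTheory Set Metric Topology

/-! ### The weighted measure on the disk -/

/-- The measure on the plane with density `1 / √(1 - ‖z‖²)` on the open unit disk. -/
noncomputable def diskMeasure : Measure (EuclideanSpace ℝ (Fin 2)) :=
  (volume.restrict (ball 0 1)).withDensity fun z => ENNReal.ofReal (1 / √(1 - ‖z‖ ^ 2))

theorem measurable_diskDensity :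
    Measurable fun z : EuclideanSpace ℝ (Fin 2) => ENNReal.ofReal (1 / √(1 - ‖z‖ ^ 2)) := by
  fun_prop

theorem integral_diskMeasure (f : EuclideanSpace ℝ (Fin 2) → ℝ) :
    ∫ z, f z ∂diskMeasure = ∫ z in ball 0 1, f z / √(1 - ‖z‖ ^ 2) := by
  rw [diskMeasure, integral_withDensity_eq_integral_toReal_smul measurable_diskDensity
    (Filter.Eventually.of_forall fun _ => ENNReal.ofReal_lt_top)]
  refine integral_congr_ae (Filter.Eventually.of_forall fun z => ?_)
  simp only [smul_eq_mul]
  rw [ENNReal.toReal_ofReal (by positivity)]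
  ring

theorem integrable_diskMeasure_iff (f : EuclideanSpace ℝ (Fin 2) → ℝ) :
    Integrable f diskMeasure ↔ IntegrableOn (fun z => f z / √(1 - ‖z‖ ^ 2)) (ball 0 1) := by
  rw [diskMeasure, integrable_withDensity_iff_integrable_smul' measurable_diskDensity
    (Filter.Eventually.of_forall fun _ => ENNReal.ofReal_lt_top), IntegrableOn]
  refine integrable_congr (Filter.Eventually.of_forall fun z => ?_)
  simp only [smul_eq_mul]
  rw [ENNReal.toReal_ofReal (by positivity)]
  ring

theorem ae_diskMeasure_mem_ball : ∀ᵐ z ∂diskMeasure, z ∈ ball (0 : EuclideanSpace ℝ (Fin 2)) 1 :=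
  (withDensity_absolutelyContinuous _ _).ae_le (ae_restrict_mem measurableSet_ball)

/-! ### Polar coordinates, total mass and integrability -/

/-- The unit vector of the plane with polar angle `φ`. -/
noncomputable def unitVec (φ : ℝ) : EuclideanSpace ℝ (Fin 2) := !₂[Real.cos φ, Real.sin φ]

theorem norm_unitVec (φ : ℝ) : ‖unitVec φ‖ = 1 := by
  simp [unitVec, EuclideanSpace.norm_eq]

theorem continuous_unitVec : Continuous unitVec := by
  unfold unitVec
  refine (PiLp.continuous_toLp 2 _).comp (continuous_pi fun i => ?_)
  fin_cases i <;> simp <;> fun_prop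

theorem integral_eq_polar (f : EuclideanSpace ℝ (Fin 2) → ℝ) :
    ∫ z, f z = ∫ p in Ioi (0 : ℝ) ×ˢ Ioo (-Real.pi) Real.pi, p.1 * f (p.1 • unitVec p.2) := by
  rw [← (PiLp.volume_preserving_toLp (Fin 2)).integral_comp
      (MeasurableEquiv.toLp 2 (Fin 2 → ℝ)).measurableEmbedding,
    ← (volume_preserving_finTwoArrow ℝ).symm.integral_comp
      (MeasurableEquiv.finTwoArrow (α := ℝ)).symm.measurableEmbedding,
    ← integral_comp_polarCoord_symm]
  refine integral_congr_ae (Filter.Eventually.of_forall fun p => ?_)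
  simp only [smul_eq_mul]
  congr 2
  ext i
  fin_cases i <;> simp [unitVec, MeasurableEquiv.finTwoArrow]

theorem integral_diskMeasure_eq_polar (f : EuclideanSpace ℝ (Fin 2) → ℝ) :
    ∫ z, f z ∂diskMeasure = ∫ p in Ioo (0 : ℝ) 1 ×ˢ Ioo (-Real.pi) Real.pi,
      p.1 / √(1 - p.1 ^ 2) * f (p.1 • unitVec p.2) := by
  rw [integral_diskMeasure, ← integral_indicator measurableSet_ball, integral_eq_polar,
    ← integral_indicator (measurableSet_Ioi.prod measurableSet_Ioo),
    ← integral_indicator (measurableSet_Ioo.prod measurableSet_Ioo)]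
  refine integral_congr_ae (Filter.Eventually.of_forall fun p => ?_)
  by_cases h0 : 0 < p.1 <;> by_cases h1 : p.1 < 1 <;>
    simp [indicator, norm_smul, norm_unitVec, abs_of_pos, h0, h1]
  congr 1
  ring

theorem hasDerivAt_neg_sqrt_one_sub_sq {r : ℝ} (h0 : 0 < r) (h1 : r < 1) :
    HasDerivAt (fun r => -√(1 - r ^ 2)) (r / √(1 - r ^ 2)) r := by
  have h : 1 - r ^ 2 ≠ 0 := by nlinarith
  convert! ((((hasDerivAt_id r).pow 2).const_sub 1).sqrt h).neg using 1
  simp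
  ring

theorem integrableOn_radialDensity :
    IntegrableOn (fun r : ℝ => r / √(1 - r ^ 2)) (Ioc 0 1) :=
  intervalIntegral.integrableOn_deriv_of_nonneg (g := fun r => -√(1 - r ^ 2)) (by fun_prop)
    (fun _ h => hasDerivAt_neg_sqrt_one_sub_sq h.1 h.2)
    (fun _ h => div_nonneg h.1.le (Real.sqrt_nonneg _))

theorem integral_radialDensity : ∫ r in Ioo (0 : ℝ) 1, r / √(1 - r ^ 2) = 1 := by
  rw [← integral_Ioc_eq_integral_Ioo, ← intervalIntegral.integral_of_le zero_le_one,
    intervalIntegral.integral_eq_sub_of_hasDerivAt_of_le zero_le_one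
      (f := fun r => -√(1 - r ^ 2)) (by fun_prop)
      (fun _ h => hasDerivAt_neg_sqrt_one_sub_sq h.1 h.2)]
  · simp
  · rw [intervalIntegrable_iff_integrableOn_Ioc_of_le zero_le_one]
    exact integrableOn_radialDensity

theorem integral_one_diskMeasure : ∫ _, (1 : ℝ) ∂diskMeasure = 2 * Real.pi := by
  rw [integral_diskMeasure_eq_polar, Measure.volume_eq_prod, ← Measure.prod_restrict,
    integral_prod_mul (fun r : ℝ => r / √(1 - r ^ 2)) (fun _ : ℝ => (1 : ℝ)),
    integral_radialDensity]
  simp [Real.pi_pos.le]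
  ring

instance isFiniteMeasure_diskMeasure : IsFiniteMeasure diskMeasure := by
  have h : Integrable (fun _ => (1 : ℝ)) diskMeasure :=
    -- The Bochner integral of a non-integrable function is 0, so the value 2π already forces
    -- finiteness.
    Integrable.of_integral_ne_zero (by rw [integral_one_diskMeasure]; positivity)
  rwa [integrable_const_iff_isFiniteMeasure one_ne_zero] at h

theorem integrable_diskMeasure_of_continuous {f : EuclideanSpace ℝ (Fin 2) → ℝ}
    (hf : Continuous f) : Integrable f diskMeasure := by
  obtain ⟨C, hC⟩ :=
    (isCompact_closedBall (0 : EuclideanSpace ℝ (Fin 2)) 1).exists_bound_of_continuousOn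
      hf.continuousOn
  refine Integrable.of_bound hf.aestronglyMeasurable C ?_
  filter_upwards [ae_diskMeasure_mem_ball] with z hz using hC z (ball_subset_closedBall hz)

/-! ### The Euler–Poisson–Darboux identity -/

theorem unitVec_eq (φ : ℝ) : unitVec φ =
    Real.cos φ • EuclideanSpace.single (0 : Fin 2) (1 : ℝ) +
      Real.sin φ • EuclideanSpace.single (1 : Fin 2) (1 : ℝ) := by
  ext i
  fin_cases i <;> simp [unitVec]

theorem hasDerivAt_unitVec (φ : ℝ) : HasDerivAt unitVec (unitVec (φ + Real.pi / 2)) φ := by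
  have h := ((Real.hasDerivAt_cos φ).smul_const (EuclideanSpace.single (0 : Fin 2) (1 : ℝ))).add
    ((Real.hasDerivAt_sin φ).smul_const (EuclideanSpace.single (1 : Fin 2) (1 : ℝ)))
  rw [unitVec_eq, Real.cos_add_pi_div_two, Real.sin_add_pi_div_two]
  exact h.congr_of_eventuallyEq (Filter.Eventually.of_forall unitVec_eq)

theorem unitVec_add_pi (φ : ℝ) : unitVec (φ + Real.pi) = -unitVec φ := by
  ext i
  fin_cases i <;> simp [unitVec]

/-- The trace of the Hessian can be read in any orthonormal frame; the mixed terms cancel in the sum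
even without symmetry. -/
theorem laplacian_eq_unitVec (f : EuclideanSpace ℝ (Fin 2) → ℝ) (y : EuclideanSpace ℝ (Fin 2))
    (φ : ℝ) : Laplacian.laplacian f y = fderiv ℝ (fderiv ℝ f) y (unitVec φ) (unitVec φ) +
      fderiv ℝ (fderiv ℝ f) y (unitVec (φ + Real.pi / 2)) (unitVec (φ + Real.pi / 2)) := by
  rw [InnerProductSpace.laplacian_eq_iteratedFDeriv_orthonormalBasis f
    (EuclideanSpace.basisFun (Fin 2) ℝ)]
  simp only [iteratedFDeriv_two_apply, Fin.sum_univ_two, unitVec_eq, Real.cos_add_pi_div_two,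
    Real.sin_add_pi_div_two, map_add, map_smul, _root_.add_apply,
    _root_.smul_apply, smul_eq_mul, EuclideanSpace.basisFun_apply,
    Matrix.cons_val_zero, Matrix.cons_val_one]
  linear_combination (-(fderiv ℝ (fderiv ℝ f) y (EuclideanSpace.single 0 1)
      (EuclideanSpace.single 0 1)) - fderiv ℝ (fderiv ℝ f) y (EuclideanSpace.single 1 1)
      (EuclideanSpace.single 1 1)) * Real.sin_sq_add_cos_sq φ

theorem integrableOn_inv_sqrt_one_sub_sq :
    IntegrableOn (fun r : ℝ => 1 / √(1 - r ^ 2)) (Ioc 0 1) :=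
  intervalIntegral.integrableOn_deriv_of_nonneg Real.continuous_arcsin.continuousOn
    (fun _ h => Real.hasDerivAt_arcsin (by linarith [h.1]) h.2.ne)
    (fun _ _ => by positivity)

/-- The weight lacks the Jacobian factor ρ because the radial and angular pieces of the identity
each contain a term not divisible by ρ. -/
theorem integrableOn_inv_sqrt_mul {H : ℝ × ℝ → ℝ} (hH : Continuous H) :
    IntegrableOn (fun p : ℝ × ℝ => 1 / √(1 - p.1 ^ 2) * H p)
      (Ioo (0 : ℝ) 1 ×ˢ Ioo (-Real.pi) Real.pi) := by
  obtain ⟨C, hC⟩ := ((isCompact_Icc (a := (0 : ℝ)) (b := 1)).prod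
    (isCompact_Icc (a := -Real.pi) (b := Real.pi))).exists_bound_of_continuousOn hH.continuousOn
  have h : IntegrableOn (fun p : ℝ × ℝ => 1 / √(1 - p.1 ^ 2) * (1 : ℝ))
      (Ioo (0 : ℝ) 1 ×ˢ Ioo (-Real.pi) Real.pi) := by
    rw [IntegrableOn, Measure.volume_eq_prod, ← Measure.prod_restrict]
    exact Integrable.mul_prod (f := fun r : ℝ => 1 / √(1 - r ^ 2)) (g := fun _ => (1 : ℝ))
      (integrableOn_inv_sqrt_one_sub_sq.mono_set Ioo_subset_Ioc_self) (integrable_const _)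
  simp only [mul_one] at h
  refine h.mul_bdd (c := C) hH.aestronglyMeasurable ?_
  filter_upwards [ae_restrict_mem (measurableSet_Ioo.prod measurableSet_Ioo)] with p hp
  exact hC p ⟨Ioo_subset_Icc_self hp.1, Ioo_subset_Icc_self hp.2⟩

theorem hasDerivAt_fderiv_radial {f : EuclideanSpace ℝ (Fin 2) → ℝ} (hf : ContDiff ℝ 2 f)
    (x : EuclideanSpace ℝ (Fin 2)) (r : ℝ) (ρ φ : ℝ) :
    HasDerivAt (fun ρ => fderiv ℝ f (x + r • ρ • unitVec φ) (unitVec φ))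
      (r * fderiv ℝ (fderiv ℝ f) (x + r • ρ • unitVec φ) (unitVec φ) (unitVec φ)) ρ := by
  have h2 : Differentiable ℝ (fderiv ℝ f) :=
    (hf.fderiv_right (m := 1) (by norm_num)).differentiable (by norm_num)
  have hc : HasDerivAt (fun ρ : ℝ => x + r • ρ • unitVec φ) (r • unitVec φ) ρ := by
    simpa using ((((hasDerivAt_id ρ).smul_const (unitVec φ)).const_smul r).const_add x)
  have := ((h2 _).hasFDerivAt.comp_hasDerivAt ρ hc).clm_apply (hasDerivAt_const ρ (unitVec φ))
  simpa using this

theorem hasDerivAt_fderiv_angular {f : EuclideanSpace ℝ (Fin 2) → ℝ} (hf : ContDiff ℝ 2 f)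
    (x : EuclideanSpace ℝ (Fin 2)) (r : ℝ) (ρ φ : ℝ) :
    HasDerivAt (fun φ => fderiv ℝ f (x + r • ρ • unitVec φ) (unitVec (φ + Real.pi / 2)))
      (r * ρ * fderiv ℝ (fderiv ℝ f) (x + r • ρ • unitVec φ) (unitVec (φ + Real.pi / 2))
        (unitVec (φ + Real.pi / 2)) - fderiv ℝ f (x + r • ρ • unitVec φ) (unitVec φ)) φ := by
  have h2 : Differentiable ℝ (fderiv ℝ f) :=
    (hf.fderiv_right (m := 1) (by norm_num)).differentiable (by norm_num)
  have hc : HasDerivAt (fun φ : ℝ => x + r • ρ • unitVec φ)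
      (r • ρ • unitVec (φ + Real.pi / 2)) φ :=
    (((hasDerivAt_unitVec φ).const_smul ρ).const_smul r).const_add x
  have he : HasDerivAt (fun φ => unitVec (φ + Real.pi / 2)) (-unitVec φ) φ := by
    have := (hasDerivAt_unitVec (φ + Real.pi / 2)).comp_add_const φ (Real.pi / 2)
    rwa [add_assoc, add_halves, unitVec_add_pi] at this
  have := ((h2 _).hasFDerivAt.comp_hasDerivAt φ hc).clm_apply he
  convert! this using 1
  simp
  ring

theorem continuous_fderiv_polar {f : EuclideanSpace ℝ (Fin 2) → ℝ} (hf : ContDiff ℝ 2 f)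
    (x : EuclideanSpace ℝ (Fin 2)) (r : ℝ)
    {g : ℝ × ℝ → EuclideanSpace ℝ (Fin 2)} (hg : Continuous g) :
    Continuous fun p : ℝ × ℝ => fderiv ℝ f (x + r • p.1 • unitVec p.2) (g p) := by
  have h1 : Continuous (fderiv ℝ f) := hf.continuous_fderiv (by norm_num)
  have := continuous_unitVec
  exact (h1.comp (by fun_prop)).clm_apply hg

theorem continuous_fderiv_fderiv_polar {f : EuclideanSpace ℝ (Fin 2) → ℝ} (hf : ContDiff ℝ 2 f)
    (x : EuclideanSpace ℝ (Fin 2)) (r : ℝ)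
    {g : ℝ × ℝ → EuclideanSpace ℝ (Fin 2)} (hg : Continuous g) :
    Continuous fun p : ℝ × ℝ => fderiv ℝ (fderiv ℝ f) (x + r • p.1 • unitVec p.2) (g p) (g p) := by
  have h1 : Continuous (fderiv ℝ (fderiv ℝ f)) :=
    (hf.fderiv_right (m := 1) (by norm_num)).continuous_fderiv (by norm_num)
  have := continuous_unitVec
  exact ((h1.comp (by fun_prop)).clm_apply hg).clm_apply hg

/-- The integrand is the ρ-derivative of -ρ√(1 - ρ²) ∂f/∂ω, with ω the radial direction; this
vanishes at ρ = 0 and ρ = 1. -/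
theorem integral_radial_eq_zero {f : EuclideanSpace ℝ (Fin 2) → ℝ} (hf : ContDiff ℝ 2 f)
    (x : EuclideanSpace ℝ (Fin 2)) (r : ℝ) (φ : ℝ) :
    ∫ ρ in Ioo (0 : ℝ) 1, 1 / √(1 - ρ ^ 2) *
      ((2 * ρ ^ 2 - 1) * fderiv ℝ f (x + r • ρ • unitVec φ) (unitVec φ) -
        r * ρ * (1 - ρ ^ 2) *
          fderiv ℝ (fderiv ℝ f) (x + r • ρ • unitVec φ) (unitVec φ) (unitVec φ)) = 0 := by
  have hc1 : Continuous fun ρ => fderiv ℝ f (x + r • ρ • unitVec φ) (unitVec φ) :=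
    (continuous_fderiv_polar hf x r (g := fun _ => unitVec φ) continuous_const).comp
      (f := fun ρ => (ρ, φ)) (by fun_prop)
  have hc2 : Continuous fun ρ =>
      fderiv ℝ (fderiv ℝ f) (x + r • ρ • unitVec φ) (unitVec φ) (unitVec φ) :=
    (continuous_fderiv_fderiv_polar hf x r (g := fun _ => unitVec φ) continuous_const).comp
      (f := fun ρ => (ρ, φ)) (by fun_prop)
  rw [← integral_Ioc_eq_integral_Ioo, ← intervalIntegral.integral_of_le zero_le_one,
    intervalIntegral.integral_eq_sub_of_hasDerivAt_of_le zero_le_one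
      (f := fun ρ => ρ * -√(1 - ρ ^ 2) * fderiv ℝ f (x + r • ρ • unitVec φ) (unitVec φ))
      (by fun_prop)]
  · simp
  · intro ρ hρ
    have h := ((hasDerivAt_id ρ).mul (hasDerivAt_neg_sqrt_one_sub_sq hρ.1 hρ.2)).mul
      (hasDerivAt_fderiv_radial hf x r ρ φ)
    convert! h using 1
    have hpos : 0 < 1 - ρ ^ 2 := by nlinarith [hρ.1, hρ.2]
    have hs : 0 < √(1 - ρ ^ 2) := Real.sqrt_pos.2 hpos
    have hs2 : √(1 - ρ ^ 2) ^ 2 = 1 - ρ ^ 2 := Real.sq_sqrt hpos.le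
    simp only [id, Pi.mul_apply]
    generalize √(1 - ρ ^ 2) = s at *
    rw [← hs2]
    field_simp
    linear_combination (fderiv ℝ f (x + r • ρ • unitVec φ) (unitVec φ)) * hs2
  · rw [intervalIntegrable_iff_integrableOn_Ioc_of_le zero_le_one]
    have hcont : Continuous fun ρ =>
        (2 * ρ ^ 2 - 1) * fderiv ℝ f (x + r • ρ • unitVec φ) (unitVec φ) -
        r * ρ * (1 - ρ ^ 2) *
          fderiv ℝ (fderiv ℝ f) (x + r • ρ • unitVec φ) (unitVec φ) (unitVec φ) := by
      fun_prop
    obtain ⟨C, hC⟩ := (isCompact_Icc (a := (0 : ℝ)) (b := 1)).exists_bound_of_continuousOn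
      hcont.continuousOn
    refine Integrable.mul_bdd (c := C) integrableOn_inv_sqrt_one_sub_sq
      hcont.aestronglyMeasurable ?_
    filter_upwards [ae_restrict_mem measurableSet_Ioc] with ρ hρ using hC ρ (Ioc_subset_Icc_self hρ)

/-- The integrand is the φ-derivative of the tangential derivative of f, which is 2π-periodic. -/
theorem integral_angular_eq_zero {f : EuclideanSpace ℝ (Fin 2) → ℝ} (hf : ContDiff ℝ 2 f)
    (x : EuclideanSpace ℝ (Fin 2)) (r : ℝ) (ρ : ℝ) :
    ∫ φ in Ioo (-Real.pi) Real.pi, (r * ρ * fderiv ℝ (fderiv ℝ f) (x + r • ρ • unitVec φ)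
        (unitVec (φ + Real.pi / 2)) (unitVec (φ + Real.pi / 2)) -
      fderiv ℝ f (x + r • ρ • unitVec φ) (unitVec φ)) = 0 := by
  have hle : -Real.pi ≤ Real.pi := by linarith [Real.pi_pos]
  have := continuous_unitVec
  have hc1 : Continuous fun φ => fderiv ℝ f (x + r • ρ • unitVec φ) (unitVec φ) :=
    (continuous_fderiv_polar hf x r (g := fun p => unitVec p.2) (by fun_prop)).comp
      (f := fun φ => (ρ, φ)) (by fun_prop)
  have hc2 : Continuous fun φ => fderiv ℝ (fderiv ℝ f) (x + r • ρ • unitVec φ)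
        (unitVec (φ + Real.pi / 2)) (unitVec (φ + Real.pi / 2)) :=
    (continuous_fderiv_fderiv_polar hf x r (g := fun p => unitVec (p.2 + Real.pi / 2))
      (by fun_prop)).comp (f := fun φ => (ρ, φ)) (by fun_prop)
  rw [← integral_Ioc_eq_integral_Ioo, ← intervalIntegral.integral_of_le hle,
    intervalIntegral.integral_eq_sub_of_hasDerivAt
      (fun φ _ => hasDerivAt_fderiv_angular hf x r ρ φ)
      (Continuous.intervalIntegrable (by fun_prop) _ _)]
  have h1 : unitVec Real.pi = unitVec (-Real.pi) := by simp [unitVec]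
  have h2 : unitVec (Real.pi + Real.pi / 2) = unitVec (-Real.pi + Real.pi / 2) := by
    simp [unitVec, Real.cos_add, Real.sin_add]
  simp only [h1, h2, sub_self]

/-- The Euler–Poisson–Darboux identity for means over the disk with the density
`1 / √(1 - ‖z‖²)`. -/
theorem integral_diskMeasure_laplacian_identity {f : EuclideanSpace ℝ (Fin 2) → ℝ}
    (hf : ContDiff ℝ 2 f) (x : EuclideanSpace ℝ (Fin 2)) (r : ℝ) :
    ∫ z, (2 * fderiv ℝ f (x + r • z) z + r * (fderiv ℝ (fderiv ℝ f) (x + r • z) z z -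
      Laplacian.laplacian f (x + r • z))) ∂diskMeasure = 0 := by
  have := continuous_unitVec
  have ha : Continuous fun p : ℝ × ℝ =>
      (2 * p.1 ^ 2 - 1) * fderiv ℝ f (x + r • p.1 • unitVec p.2) (unitVec p.2) -
        r * p.1 * (1 - p.1 ^ 2) *
          fderiv ℝ (fderiv ℝ f) (x + r • p.1 • unitVec p.2) (unitVec p.2) (unitVec p.2) := by
    have h1 := continuous_fderiv_polar hf x r (g := fun p => unitVec p.2) (by fun_prop)
    have h2 := continuous_fderiv_fderiv_polar hf x r (g := fun p => unitVec p.2) (by fun_prop)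
    fun_prop
  have hb : Continuous fun p : ℝ × ℝ =>
      r * p.1 * fderiv ℝ (fderiv ℝ f) (x + r • p.1 • unitVec p.2)
        (unitVec (p.2 + Real.pi / 2)) (unitVec (p.2 + Real.pi / 2)) -
      fderiv ℝ f (x + r • p.1 • unitVec p.2) (unitVec p.2) := by
    have h1 := continuous_fderiv_polar hf x r (g := fun p => unitVec p.2) (by fun_prop)
    have h2 := continuous_fderiv_fderiv_polar hf x r
      (g := fun p => unitVec (p.2 + Real.pi / 2)) (by fun_prop)
    fun_prop
  have hA := integrableOn_inv_sqrt_mul ha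
  have hB := integrableOn_inv_sqrt_mul hb
  rw [integral_diskMeasure_eq_polar]
  -- The radial derivative of f is added and subtracted, so that each piece becomes exact in one
  -- variable.
  trans ∫ p in Ioo (0 : ℝ) 1 ×ˢ Ioo (-Real.pi) Real.pi, (1 / √(1 - p.1 ^ 2) *
      ((2 * p.1 ^ 2 - 1) * fderiv ℝ f (x + r • p.1 • unitVec p.2) (unitVec p.2) -
        r * p.1 * (1 - p.1 ^ 2) *
          fderiv ℝ (fderiv ℝ f) (x + r • p.1 • unitVec p.2) (unitVec p.2) (unitVec p.2)) -
      1 / √(1 - p.1 ^ 2) * (r * p.1 * fderiv ℝ (fderiv ℝ f) (x + r • p.1 • unitVec p.2)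
        (unitVec (p.2 + Real.pi / 2)) (unitVec (p.2 + Real.pi / 2)) -
      fderiv ℝ f (x + r • p.1 • unitVec p.2) (unitVec p.2)))
  · refine integral_congr_ae (Filter.Eventually.of_forall fun p => ?_)
    simp only [laplacian_eq_unitVec f _ p.2, map_smul, _root_.smul_apply, smul_eq_mul]
    ring
  · rw [integral_sub hA hB]
    rw [IntegrableOn, Measure.volume_eq_prod, ← Measure.prod_restrict] at hA hB
    -- Opposite orders of integration: the first piece is integrated in ρ first, the second in φ
    -- first.
    rw [Measure.volume_eq_prod, ← Measure.prod_restrict, integral_prod_symm _ hA,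
      integral_prod _ hB]
    simp only [integral_radial_eq_zero hf, integral_const_mul, integral_angular_eq_zero hf]
    simp

/-! ### Dependence of disk integrals on a parameter -/

theorem hasDerivAt_integral_diskMeasure {F F' : ℝ → EuclideanSpace ℝ (Fin 2) → ℝ} {S : Set ℝ}
    (hS : IsOpen S) (hF : ContinuousOn (fun p : ℝ × _ => F p.1 p.2) (S ×ˢ univ))
    (hF' : ContinuousOn (fun p : ℝ × _ => F' p.1 p.2) (S ×ˢ univ))
    (hd : ∀ σ ∈ S, ∀ z, HasDerivAt (fun σ => F σ z) (F' σ z) σ) {σ : ℝ} (hσ : σ ∈ S) :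
    HasDerivAt (fun σ => ∫ z, F σ z ∂diskMeasure) (∫ z, F' σ z ∂diskMeasure) σ := by
  have hslice : ∀ {G : ℝ → EuclideanSpace ℝ (Fin 2) → ℝ},
      ContinuousOn (fun p : ℝ × _ => G p.1 p.2) (S ×ˢ univ) → ∀ ρ ∈ S, Continuous (G ρ) :=
    fun hG ρ hρ => hG.comp_continuous (f := fun z => (ρ, z)) (by fun_prop) fun _ => ⟨hρ, trivial⟩
  obtain ⟨ε, hε, hεS⟩ := nhds_basis_closedBall.mem_iff.1 (hS.mem_nhds hσ)
  obtain ⟨C, hC⟩ := ((isCompact_closedBall σ ε).prod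
    (isCompact_closedBall (0 : EuclideanSpace ℝ (Fin 2)) 1)).exists_bound_of_continuousOn
      (hF'.mono (prod_mono hεS (subset_univ _)))
  refine (hasDerivAt_integral_of_dominated_loc_of_deriv_le (bound := fun _ => C)
    (closedBall_mem_nhds σ hε) ?_ (integrable_diskMeasure_of_continuous (hslice hF σ hσ))
    (hslice hF' σ hσ).aestronglyMeasurable ?_ (integrable_const _) ?_).2
  · filter_upwards [hS.mem_nhds hσ] with ρ hρ using (hslice hF ρ hρ).aestronglyMeasurable
  · filter_upwards [ae_diskMeasure_mem_ball] with z hz ρ hρ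
    exact hC (ρ, z) ⟨hρ, ball_subset_closedBall hz⟩
  · exact Filter.Eventually.of_forall fun z ρ hρ => hd ρ (hεS hρ) z

theorem continuous_integral_diskMeasure {F : ℝ → EuclideanSpace ℝ (Fin 2) → ℝ}
    (hF : Continuous fun p : ℝ × _ => F p.1 p.2) :
    Continuous fun σ => ∫ z, F σ z ∂diskMeasure := by
  have h := continuous_parametric_integral_of_continuous (μ := diskMeasure) (f := F) hF
    (isCompact_closedBall (0 : EuclideanSpace ℝ (Fin 2)) 1)
  rwa [Measure.restrict_eq_self_of_ae_mem] at h
  filter_upwards [ae_diskMeasure_mem_ball] with z hz using ball_subset_closedBall hz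

/-! ### Derivatives of space and time slices, and along the cone -/

section

variable {U : EuclideanSpace ℝ (Fin 2) × ℝ → ℝ} {J : Set ℝ}

theorem contDiffAt_of_contDiffOn_univ_prod (hU : ContDiffOn ℝ 2 U (univ ×ˢ J)) (hJ : IsOpen J)
    (y : EuclideanSpace ℝ (Fin 2)) {t : ℝ} (ht : t ∈ J) : ContDiffAt ℝ 2 U (y, t) :=
  hU.contDiffAt ((isOpen_univ.prod hJ).mem_nhds ⟨trivial, ht⟩)

theorem contDiff_slice (hU : ContDiffOn ℝ 2 U (univ ×ˢ J)) {t : ℝ} (ht : t ∈ J) :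
    ContDiff ℝ 2 fun y => U (y, t) := by
  rw [← contDiffOn_univ]
  exact hU.comp (f := fun y => (y, t)) (by fun_prop) fun _ _ => ⟨trivial, ht⟩

theorem hasFDerivAt_fderiv (hU : ContDiffOn ℝ 2 U (univ ×ˢ J)) (hJ : IsOpen J)
    (y : EuclideanSpace ℝ (Fin 2)) {t : ℝ} (ht : t ∈ J) :
    HasFDerivAt (fderiv ℝ U) (fderiv ℝ (fderiv ℝ U) (y, t)) (y, t) :=
  (((contDiffAt_of_contDiffOn_univ_prod hU hJ y ht).fderiv_right (m := 1)
    (by norm_num)).differentiableAt (by norm_num)).hasFDerivAt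

theorem hasFDerivAt_of_contDiffOn (hU : ContDiffOn ℝ 2 U (univ ×ˢ J)) (hJ : IsOpen J)
    (y : EuclideanSpace ℝ (Fin 2)) {t : ℝ} (ht : t ∈ J) :
    HasFDerivAt U (fderiv ℝ U (y, t)) (y, t) :=
  ((contDiffAt_of_contDiffOn_univ_prod hU hJ y ht).differentiableAt (by norm_num)).hasFDerivAt

theorem hasFDerivAt_prodMk_time (y : EuclideanSpace ℝ (Fin 2)) (t : ℝ) :
    HasFDerivAt (fun y : EuclideanSpace ℝ (Fin 2) => (y, t))
      (ContinuousLinearMap.inl ℝ (EuclideanSpace ℝ (Fin 2)) ℝ) y :=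
  hasFDerivAt_prodMk_left y t

theorem fderiv_slice (hU : ContDiffOn ℝ 2 U (univ ×ˢ J)) (hJ : IsOpen J) {t : ℝ} (ht : t ∈ J)
    (y w : EuclideanSpace ℝ (Fin 2)) :
    fderiv ℝ (fun y => U (y, t)) y w = fderiv ℝ U (y, t) (w, 0) := by
  have h := (hasFDerivAt_of_contDiffOn hU hJ y ht).comp y (hasFDerivAt_prodMk_time y t)
  rw [show (fun y => U (y, t)) = U ∘ fun y => (y, t) from rfl, h.fderiv]
  simp

theorem fderiv_fderiv_slice (hU : ContDiffOn ℝ 2 U (univ ×ˢ J)) (hJ : IsOpen J) {t : ℝ}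
    (ht : t ∈ J) (y v w : EuclideanSpace ℝ (Fin 2)) :
    fderiv ℝ (fderiv ℝ fun y => U (y, t)) y v w =
      fderiv ℝ (fderiv ℝ U) (y, t) (v, 0) (w, 0) := by
  have h1 : HasFDerivAt (fderiv ℝ fun y => U (y, t)) (fderiv ℝ (fderiv ℝ fun y => U (y, t)) y) y :=
    (((contDiff_slice hU ht).fderiv_right (m := 1) (by norm_num)).differentiable
      (by norm_num) y).hasFDerivAt
  have h2 := h1.clm_apply (hasFDerivAt_const w y)
  have h3 := ((hasFDerivAt_fderiv hU hJ y ht).comp y (hasFDerivAt_prodMk_time y t)).clm_apply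
    (hasFDerivAt_const ((w, 0) : EuclideanSpace ℝ (Fin 2) × ℝ) y)
  simp only [fderiv_slice hU hJ ht] at h2
  simpa using DFunLike.congr_fun (h2.unique h3) v

theorem deriv_deriv_slice (hU : ContDiffOn ℝ 2 U (univ ×ˢ J)) (hJ : IsOpen J) {t : ℝ}
    (ht : t ∈ J) (y : EuclideanSpace ℝ (Fin 2)) :
    deriv (deriv fun s => U (y, s)) t = fderiv ℝ (fderiv ℝ U) (y, t) (0, 1) (0, 1) := by
  have hc : ∀ s : ℝ, HasDerivAt (fun s : ℝ => (y, s)) (0, 1) s := fun s =>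
    (hasDerivAt_const s y).prodMk (hasDerivAt_id s)
  have h : deriv (fun s => U (y, s)) =ᶠ[𝓝 t] fun s => fderiv ℝ U (y, s) (0, 1) := by
    filter_upwards [hJ.mem_nhds ht] with s hs
    exact ((hasFDerivAt_of_contDiffOn hU hJ y hs).comp_hasDerivAt s (hc s)).deriv
  rw [h.deriv_eq]
  have h2 := ((hasFDerivAt_fderiv hU hJ y ht).comp_hasDerivAt t (hc t)).clm_apply
    (hasDerivAt_const t ((0, 1) : EuclideanSpace ℝ (Fin 2) × ℝ))
  simpa using h2.deriv

/-- The curve has velocity (cz, -1) and the added term uses direction (cz, 1). In the first-order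
part the time components cancel; in the second-order part symmetry of the Hessian removes the mixed
terms. -/
theorem hasDerivAt_along_cone (hU : ContDiffOn ℝ 2 U (univ ×ˢ J)) (hJ : IsOpen J) (c t : ℝ)
    (x z : EuclideanSpace ℝ (Fin 2)) {σ : ℝ} (hσ : t - σ ∈ J) :
    HasDerivAt (fun σ => U (x + (c * σ) • z, t - σ) +
        σ * fderiv ℝ U (x + (c * σ) • z, t - σ) (c • z, 1))
      (2 * fderiv ℝ U (x + (c * σ) • z, t - σ) (c • z, 0) +
        σ * (fderiv ℝ (fderiv ℝ U) (x + (c * σ) • z, t - σ) (c • z, 0) (c • z, 0) -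
          fderiv ℝ (fderiv ℝ U) (x + (c * σ) • z, t - σ) (0, 1) (0, 1))) σ := by
  have hc : HasDerivAt (fun σ : ℝ => (x + (c * σ) • z, t - σ)) (c • z, -1) σ := by
    refine HasDerivAt.prodMk ?_ ((hasDerivAt_id σ).const_sub t)
    simpa using ((((hasDerivAt_id σ).const_mul c).smul_const z).const_add x)
  have h1 : HasDerivAt (fun σ => U (x + (c * σ) • z, t - σ))
      (fderiv ℝ U (x + (c * σ) • z, t - σ) (c • z, -1)) σ :=
    (hasFDerivAt_of_contDiffOn hU hJ (x + (c * σ) • z) hσ).comp_hasDerivAt σ hc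
  have h2 : HasDerivAt (fun σ => fderiv ℝ U (x + (c * σ) • z, t - σ))
      (fderiv ℝ (fderiv ℝ U) (x + (c * σ) • z, t - σ) (c • z, -1)) σ :=
    (hasFDerivAt_fderiv hU hJ (x + (c * σ) • z) hσ).comp_hasDerivAt σ hc
  have h3 : HasDerivAt (fun σ => fderiv ℝ U (x + (c * σ) • z, t - σ) (c • z, 1))
      (fderiv ℝ (fderiv ℝ U) (x + (c * σ) • z, t - σ) (c • z, -1) (c • z, 1)) σ := by
    simpa using h2.clm_apply (hasDerivAt_const σ ((c • z, 1) : EuclideanSpace ℝ (Fin 2) × ℝ))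
  have hsymm := (contDiffAt_of_contDiffOn_univ_prod hU hJ (x + (c * σ) • z) hσ).isSymmSndFDerivAt
    (by simp)
  have hs := hsymm (c • z, 0) (0, 1)
  refine (h1.fun_add ((hasDerivAt_id' σ).fun_mul h3)).congr_deriv ?_
  have e1 : ((c • z, -1) : EuclideanSpace ℝ (Fin 2) × ℝ) = (c • z, 0) - (0, 1) := by simp
  have e2 : ((c • z, 1) : EuclideanSpace ℝ (Fin 2) × ℝ) = (c • z, 0) + (0, 1) := by simp
  rw [e1, e2]
  generalize fderiv ℝ (fderiv ℝ U) (x + (c * σ) • z, t - σ) = B at *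
  generalize fderiv ℝ U (x + (c * σ) • z, t - σ) = A at *
  simp only [map_add, map_sub, _root_.sub_apply, hs]
  ring

end

/-! ### Cone representations at interior times -/

/-- The one-sided representation of a solution by data on the base of its characteristic cone;
`c` and `τ` may have either sign. -/
theorem integral_diskMeasure_cone {U : EuclideanSpace ℝ (Fin 2) × ℝ → ℝ} {J : Set ℝ}
    (hU : ContDiffOn ℝ 2 U (univ ×ˢ J)) (hJ : IsOpen J) (hJc : J.OrdConnected) (c : ℝ)
    (hwave : ∀ y, ∀ t ∈ J, fderiv ℝ (fderiv ℝ U) (y, t) (0, 1) (0, 1) =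
      c ^ 2 * Laplacian.laplacian (fun y => U (y, t)) y)
    (x : EuclideanSpace ℝ (Fin 2)) {t τ : ℝ} (ht : t ∈ J) (htτ : t + τ ∈ J) :
    ∫ z, (U (x + (c * τ) • z, t) + τ * fderiv ℝ U (x + (c * τ) • z, t) (c • z, 1)) ∂diskMeasure =
      2 * Real.pi * U (x, t + τ) := by
  -- Here σ is the depth below the apex time t + τ: σ = 0 is the apex and σ = τ the base.
  set S : Set ℝ := (fun σ => t + τ - σ) ⁻¹' J with hSdef
  have hS : IsOpen S := hJ.preimage (by fun_prop)
  have hSc : IsPreconnected S := by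
    refine OrdConnected.isPreconnected ⟨fun a ha b hb s hs => ?_⟩
    exact hJc.out hb ha ⟨by linarith [hs.2], by linarith [hs.1]⟩
  have hγ : ContinuousOn (fun p : ℝ × EuclideanSpace ℝ (Fin 2) =>
      (x + (c * p.1) • p.2, t + τ - p.1)) (S ×ˢ univ) := by fun_prop
  have hmaps : MapsTo (fun p : ℝ × EuclideanSpace ℝ (Fin 2) =>
      (x + (c * p.1) • p.2, t + τ - p.1)) (S ×ˢ univ) (univ ×ˢ J) := fun p hp => ⟨trivial, hp.1⟩
  have hopen : IsOpen ((univ : Set (EuclideanSpace ℝ (Fin 2))) ×ˢ J) := isOpen_univ.prod hJ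
  have hU1 : ContDiffOn ℝ 1 (fderiv ℝ U) (univ ×ˢ J) :=
    hU.fderiv_of_isOpen hopen (by norm_num)
  have hU2 : ContinuousOn (fderiv ℝ (fderiv ℝ U)) (univ ×ˢ J) :=
    hU1.continuousOn_fderiv_of_isOpen hopen (by norm_num)
  have c0 := hU.continuousOn.comp hγ hmaps
  have c1 := hU1.continuousOn.comp hγ hmaps
  have c2 := hU2.comp hγ hmaps
  have hderiv : ∀ σ ∈ S, HasDerivAt (fun σ => ∫ z, (U (x + (c * σ) • z, t + τ - σ) +
      σ * fderiv ℝ U (x + (c * σ) • z, t + τ - σ) (c • z, 1)) ∂diskMeasure) 0 σ := by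
    intro σ hσ
    refine (hasDerivAt_integral_diskMeasure hS ?_ ?_
      (fun σ hσ z => hasDerivAt_along_cone hU hJ c (t + τ) x z hσ) hσ).congr_deriv ?_
    · exact c0.add (continuousOn_fst.mul (c1.clm_apply (by fun_prop)))
    · exact (continuousOn_const.mul (c1.clm_apply (by fun_prop))).add (continuousOn_fst.mul
        (((c2.clm_apply (by fun_prop)).clm_apply (by fun_prop)).sub
          ((c2.clm_apply (by fun_prop)).clm_apply (by fun_prop))))
    · have h := integral_diskMeasure_laplacian_identity (contDiff_slice hU hσ) x (c * σ)
      replace h := congrArg (c * ·) h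
      simp only [mul_zero, ← integral_const_mul] at h
      refine (integral_congr_ae (Filter.Eventually.of_forall fun z => ?_)).trans h
      have e : ((c • z, 0) : EuclideanSpace ℝ (Fin 2) × ℝ) = c • (z, 0) := by simp
      simp only [hwave _ _ hσ, fderiv_slice hU hJ hσ, fderiv_fderiv_slice hU hJ hσ, e, map_smul,
        _root_.smul_apply, smul_eq_mul]
      ring
  have hconst := hS.is_const_of_deriv_eq_zero hSc
    (fun σ hσ => (hderiv σ hσ).differentiableAt.differentiableWithinAt)
    (fun σ hσ => (hderiv σ hσ).deriv) (x := τ) (y := 0) (by simpa [hSdef] using ht)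
    (by simpa [hSdef] using htτ)
  simp only [add_sub_cancel_right, mul_zero, zero_smul, add_zero, sub_zero, zero_mul] at hconst
  rw [hconst, ← integral_one_diskMeasure, ← integral_mul_const]
  simp

/-- The cone formula is used for (c, τ) and (-c, -τ): the product cτ, hence the base disk, is
unchanged, while the time-derivative term changes sign. -/
theorem integral_diskMeasure_three_level {U : EuclideanSpace ℝ (Fin 2) × ℝ → ℝ} {J : Set ℝ}
    (hU : ContDiffOn ℝ 2 U (univ ×ˢ J)) (hJ : IsOpen J) (hJc : J.OrdConnected) (c : ℝ)
    (hwave : ∀ y, ∀ t ∈ J, fderiv ℝ (fderiv ℝ U) (y, t) (0, 1) (0, 1) =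
      c ^ 2 * Laplacian.laplacian (fun y => U (y, t)) y)
    (x : EuclideanSpace ℝ (Fin 2)) {t τ : ℝ} (ht : t ∈ J) (hp : t + τ ∈ J) (hm : t - τ ∈ J) :
    ∫ z, (U (x + (c * τ) • z, t) +
        c * τ * fderiv ℝ (fun y => U (y, t)) (x + (c * τ) • z) z) ∂diskMeasure =
      Real.pi * (U (x, t + τ) + U (x, t - τ)) := by
  have h1 := integral_diskMeasure_cone hU hJ hJc c hwave x ht hp
  have h2 := integral_diskMeasure_cone hU hJ hJc (-c) (τ := -τ) (by simpa using hwave) x ht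
    (by simpa [sub_eq_add_neg] using hm)
  simp only [neg_mul_neg, ← sub_eq_add_neg] at h2
  have hopen : IsOpen ((univ : Set (EuclideanSpace ℝ (Fin 2))) ×ˢ J) := isOpen_univ.prod hJ
  have c0 : Continuous fun z => U (x + (c * τ) • z, t) :=
    hU.continuousOn.comp_continuous (by fun_prop) fun _ => ⟨trivial, ht⟩
  have c1 : Continuous fun z => fderiv ℝ U (x + (c * τ) • z, t) :=
    (hU.continuousOn_fderiv_of_isOpen hopen (by norm_num)).comp_continuous (by fun_prop)
      fun _ => ⟨trivial, ht⟩
  have hi1 := integrable_diskMeasure_of_continuous (c0.add (continuous_const (y := τ) |>.mul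
    (c1.clm_apply (g := fun z => (c • z, 1)) (by fun_prop))))
  have hi2 := integrable_diskMeasure_of_continuous (c0.add (continuous_const (y := -τ) |>.mul
    (c1.clm_apply (g := fun z => (-c • z, 1)) (by fun_prop))))
  have h3 := integral_add hi1 hi2
  simp only [Pi.add_apply, Pi.mul_apply] at h3
  rw [h1, h2] at h3
  have h4 : ∀ z, U (x + (c * τ) • z, t) +
        c * τ * fderiv ℝ (fun y => U (y, t)) (x + (c * τ) • z) z = (1 / 2) *
      (U (x + (c * τ) • z, t) + τ * fderiv ℝ U (x + (c * τ) • z, t) (c • z, 1) +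
        (U (x + (c * τ) • z, t) + -τ * fderiv ℝ U (x + (c * τ) • z, t) (-c • z, 1))) := by
    intro z
    have e1 : ((c • z, 1) : EuclideanSpace ℝ (Fin 2) × ℝ) = c • (z, 0) + (0, 1) := by simp
    have e2 : ((-c • z, 1) : EuclideanSpace ℝ (Fin 2) × ℝ) = (-c) • (z, 0) + (0, 1) := by simp
    rw [fderiv_slice hU hJ ht, e1, e2]
    simp only [map_add, map_smul, smul_eq_mul]
    ring
  simp only [h4]
  rw [integral_const_mul, h3]
  ring

/-! ### Passage to the end points of the interval -/

theorem continuous_mean_add_radial {f : EuclideanSpace ℝ (Fin 2) → ℝ} (hf : ContDiff ℝ 1 f)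
    (x : EuclideanSpace ℝ (Fin 2)) :
    Continuous fun p : ℝ × EuclideanSpace ℝ (Fin 2) =>
      f (x + p.1 • p.2) + p.1 * fderiv ℝ f (x + p.1 • p.2) p.2 := by
  have h0 := hf.continuous
  have h1 : Continuous fun p : ℝ × EuclideanSpace ℝ (Fin 2) => fderiv ℝ f (x + p.1 • p.2) :=
    (hf.continuous_fderiv (by norm_num)).comp (by fun_prop)
  have h2 := h1.clm_apply continuous_snd
  fun_prop

theorem waveKernelIntegrand_eq (c τ : ℝ) {f : EuclideanSpace ℝ (Fin 2) → ℝ}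
    (x : EuclideanSpace ℝ (Fin 2)) :
    waveKernelIntegrand c τ f x = fun z => (f (x + (c * τ) • z) +
      c * τ * fderiv ℝ f (x + (c * τ) • z) z) / √(1 - ‖z‖ ^ 2) := by
  ext z
  simp only [waveKernelIntegrand, inner_gradient_left]

namespace IsWaveSolutionOn

variable {c : ℝ} {I : Set ℝ} {u : EuclideanSpace ℝ (Fin 2) → ℝ → ℝ}

theorem fderiv_fderiv_time (hu : IsWaveSolutionOn c I u) (y : EuclideanSpace ℝ (Fin 2)) {t : ℝ}
    (ht : t ∈ interior I) :
    fderiv ℝ (fderiv ℝ fun p : EuclideanSpace ℝ (Fin 2) × ℝ => u p.1 p.2) (y, t) (0, 1) (0, 1) =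
      c ^ 2 * Laplacian.laplacian (fun y => u y t) y := by
  rw [← deriv_deriv_slice hu.contDiffOn isOpen_interior ht]
  exact sub_eq_zero.1 (hu.equation y t ht)

theorem integral_diskMeasure_eq (hu : IsWaveSolutionOn c I u) (hI : I.OrdConnected) {t τ : ℝ}
    (hp : t + τ ∈ I) (hm : t - τ ∈ I) (ht : t ∈ interior I) (x : EuclideanSpace ℝ (Fin 2)) :
    ∫ z, (u (x + (c * τ) • z) t +
        c * τ * fderiv ℝ (fun y => u y t) (x + (c * τ) • z) z) ∂diskMeasure =
      Real.pi * (u x (t + τ) + u x (t - τ)) := by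
  have hseg : ∀ s ∈ Icc (0 : ℝ) 1, t + s * τ ∈ I ∧ t - s * τ ∈ I := by
    intro s hs
    have hconv : Convex ℝ I := hI.convex
    constructor
    · have := hconv hp hm (a := (1 + s) / 2) (b := (1 - s) / 2) (by linarith [hs.1])
        (by linarith [hs.2]) (by ring)
      convert this using 1
      simp only [smul_eq_mul]
      ring
    · have := hconv hp hm (a := (1 - s) / 2) (b := (1 + s) / 2) (by linarith [hs.2])
        (by linarith [hs.1]) (by ring)
      convert this using 1
      simp only [smul_eq_mul]
      ring
  have hint : ∀ s ∈ Ico (0 : ℝ) 1, t + s * τ ∈ interior I ∧ t - s * τ ∈ interior I := by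
    intro s hs
    -- The interior point t has weight 1 - s > 0, so the combination stays interior even if t ± τ
    -- are end points of I.
    have h := fun {b : ℝ} (hb : b ∈ I) => hI.convex.combo_interior_self_mem_interior ht hb
      (a := 1 - s) (b := s) (by linarith [hs.2]) hs.1 (by ring)
    constructor
    · convert h hp using 1
      simp only [smul_eq_mul]
      ring
    · convert h hm using 1
      simp only [smul_eq_mul]
      ring
  have hcont : ∀ b : ℝ → ℝ, Continuous b → (∀ s ∈ Icc (0 : ℝ) 1, b s ∈ I) →
      ContinuousOn (fun s => u x (b s)) (Icc 0 1) := fun b hb hbI =>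
    hu.continuousOn.comp (f := fun s => (x, b s)) (by fun_prop) fun s hs => ⟨trivial, hbI s hs⟩
  have hL : Continuous fun s : ℝ => ∫ z, (u (x + (c * (s * τ)) • z) t +
      c * (s * τ) * fderiv ℝ (fun y => u y t) (x + (c * (s * τ)) • z) z) ∂diskMeasure :=
    (continuous_integral_diskMeasure (F := fun r z =>
      u (x + r • z) t + r * fderiv ℝ (fun y => u y t) (x + r • z) z)
      (continuous_mean_add_radial ((contDiff_slice hu.contDiffOn ht).of_le (by norm_num)) x)).comp
      (f := fun s => c * (s * τ)) (by fun_prop)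
  have heq : EqOn (fun s : ℝ => ∫ z, (u (x + (c * (s * τ)) • z) t +
      c * (s * τ) * fderiv ℝ (fun y => u y t) (x + (c * (s * τ)) • z) z) ∂diskMeasure)
      (fun s => Real.pi * (u x (t + s * τ) + u x (t - s * τ))) (Ico 0 1) := fun s hs =>
    integral_diskMeasure_three_level hu.contDiffOn isOpen_interior
      hI.convex.interior.ordConnected c (fun y t ht => hu.fderiv_fderiv_time y ht) x ht
      (hint s hs).1 (hint s hs).2
  -- Both sides are continuous on [0, 1], so equality for s < 1 extends to s = 1.
  have := heq.of_subset_closure hL.continuousOn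
    (continuousOn_const.mul ((hcont _ (by fun_prop) fun s hs => (hseg s hs).1).add
      (hcont _ (by fun_prop) fun s hs => (hseg s hs).2)))
    Ico_subset_Icc_self (closure_Ico zero_ne_one).ge (right_mem_Icc.2 zero_le_one)
  simpa using this

end IsWaveSolutionOn

theorem mainTheorem6 (c : ℝ) (hc : 0 < c) (I : Set ℝ) (hI : I.OrdConnected)
    (u : EuclideanSpace ℝ (Fin 2) → ℝ → ℝ) (hu : IsWaveSolutionOn c I u)
    (tstar τ : ℝ) (hplus : tstar + τ ∈ I) (hminus : tstar - τ ∈ I)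
    (x : EuclideanSpace ℝ (Fin 2)) :
    MeasureTheory.IntegrableOn (waveKernelIntegrand c τ (fun y => u y tstar) x)
        (Metric.ball 0 1) MeasureTheory.volume ∧
      u x (tstar + τ) + u x (tstar - τ) =
        1 / Real.pi * ∫ z in Metric.ball (0 : EuclideanSpace ℝ (Fin 2)) 1,
          waveKernelIntegrand c τ (fun y => u y tstar) x z := by
  rw [waveKernelIntegrand_eq, ← integrable_diskMeasure_iff, ← integral_diskMeasure]
  -- For τ = 0 the time may be an end point of I, where the spatial slice need not be
  -- differentiable; the factor cτ = 0 removes the gradient and only the mass 2π matters.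
  rcases eq_or_ne τ 0 with rfl | hτ
  · have h := integral_one_diskMeasure
    simp only [mul_zero, zero_smul, add_zero, zero_mul, sub_zero]
    refine ⟨integrable_const _, ?_⟩
    rw [← one_mul (u x tstar), integral_mul_const, h]
    field_simp
    ring
  · have ht : tstar ∈ interior I := by
      rw [mem_interior_iff_mem_nhds]
      rcases lt_or_gt_of_ne hτ with h | h
      · exact Filter.mem_of_superset (Icc_mem_nhds (by linarith) (by linarith))
          (hI.out hplus hminus)
      · exact Filter.mem_of_superset (Icc_mem_nhds (by linarith) (by linarith))
          (hI.out hminus hplus)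
    refine ⟨integrable_diskMeasure_of_continuous ?_, ?_⟩
    · exact (continuous_mean_add_radial
        ((contDiff_slice hu.contDiffOn ht).of_le (by norm_num)) x).comp
        (f := fun z => (c * τ, z)) (by fun_prop)
    · rw [hu.integral_diskMeasure_eq hI hplus hminus ht x]
      field_simp
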